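/- Write $\mathbb{C}^2=X\times Y$. Let $P\subset X$ and $Q\subset Y$ be open, bounded, nondegenerate triangular regions with vertices $P_1,P_2,P_3$ and $Q_1,Q_2,Q_3$, and let $f\colon P\to Q$ be the conformal bijection that extends to a homeomorphism $\bar P\to\bar Q$ with $f(P_i)=Q_i$ for $i=1,2,3$ (the labels being such that such an $f$ exists); the graph of $f$ on $P$ is the triangular graph $P|Q$. The Riemann surface $[P|Q]\subset\mathbb{C}^2$ determined by $P|Q$ consists of all points $(x,g(x))$, $x\in U$, where $g$ is a holomorphic function on a domain $U$ that is obtained from $(P,f)$ by a finite chain of direct analytic continuations (consecutive domains meet, and the functions agree on the whole intersection), together with all points $(x_0,y_0)$ near which this complete global analytic function behaves like an algebraic curve $(y-y_0)^n=c(x-x_0)^m$, with $m,n\ge 1$ and $c\ne 0$; that is, on a punctured disk about $w=0$ it is given by $x=x_0+w^n$, $y=y_0+w^m u(w)$ with $u$ holomorphic on the whole disk and $u(0)\neq 0$. The isometries of $X\times Y$ are the elements of the group generated by $(x,y)\mapsto(\bar x,\bar y)$, the rotations $(x,y)\mapsto(e^{i\theta}x,e^{i\phi}y)$ and the translations $(x,y)\mapsto(x+u,y+v)$.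 The lattice group $\Lambda$ of $[P|Q]$ is the group of all translations $(u,v)$ that map $[P|Q]$ onto itself. $[P|Q]$ is called crystallographic if $\Lambda$ has rank $4$, i.e. is free abelian on four generators, and $|\Lambda|=\sqrt{\det\Lambda}>0$, where $\det\Lambda$ is the Gram determinant of the generators in $\mathbb{R}^4=\mathbb{C}^2$ (equivalently, the generators are linearly independent over $\mathbb{R}$). The section of $[P|Q]$ at $x\in X$ is $\mathcal{A}(x)=\{y\in Y\colon (x,y)\in[P|Q]\}$. Lemma. If $[P|Q]$ is crystallographic, then it is finitely discrete: there exist $r>0$ and $N\in\mathbb{N}$ such that for all $x\in X$ and all $y\in Y$ the open disk $B_r(y)\subset Y$ of radius $r$ about $y$ contains at most $N$ points of $\mathcal{A}(x)$. -/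

import Mathlib

noncomputable section

namespace TriSurf

/-! ## Analytic continuation and immersed Riemann surfaces

`ℂ × ℂ` is `X × Y`. -/

/-- A function element `(U, f)`: a domain `U ⊆ ℂ` and a holomorphic function on it. Only the values
of `fn` on `dom` matter. -/
structure FunctionElement where
  dom : Set ℂ
  fn : ℂ → ℂ
  isOpen_dom : IsOpen dom
  isConnected_dom : IsConnected dom
  differentiableOn_fn : DifferentiableOn ℂ fn dom

namespace FunctionElement

/-- Two function elements are direct analytic continuations of each other. -/
def IsDirectContinuation (F₁ F₂ : FunctionElement) : Prop :=
  (F₁.dom ∩ F₂.dom).Nonempty ∧ Set.EqOn F₁.fn F₂.fn (F₁.dom ∩ F₂.dom)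

/-- The complete, global analytic function determined by `F₀`: all function elements that are
joined to `F₀` by a finite chain of direct analytic continuations. -/
def globalFunction (F₀ : FunctionElement) : Set FunctionElement :=
  {F | Relation.ReflTransGen IsDirectContinuation F₀ F}

/-- The points `(x, f x)` with `x ∈ U`, for a function element `(U, f)` of the complete global
analytic function determined by `F₀`. -/
def elementPoints (F₀ : FunctionElement) : Set (ℂ × ℂ) :=
  {z | ∃ F ∈ F₀.globalFunction, z.1 ∈ F.dom ∧ F.fn z.1 = z.2}

/-- The points `(x₀, y₀)` near which the complete global analytic function determined by `F₀`
behaves like the algebraic curve `(y - y₀) ^ n = c * (x - x₀) ^ m`, `c ≠ 0`: over a punctured disk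
it is parametrized by `x = x₀ + w ^ n`, `y = y₀ + w ^ m * u w` with `u` holomorphic on the disk,
`u 0 ≠ 0` (so that `c = u 0 ^ n`). -/
def algebraicPoints (F₀ : FunctionElement) : Set (ℂ × ℂ) :=
  {z | ∃ m n : ℕ, 0 < m ∧ 0 < n ∧ ∃ ρ : ℝ, 0 < ρ ∧ ∃ u : ℂ → ℂ,
    DifferentiableOn ℂ u (Metric.ball 0 ρ) ∧ u 0 ≠ 0 ∧
    ∀ w ∈ Metric.ball (0 : ℂ) ρ, w ≠ 0 →
      ∃ F ∈ F₀.globalFunction, z.1 + w ^ n ∈ F.dom ∧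
        ∀ᶠ ζ in nhds w, F.fn (z.1 + ζ ^ n) = z.2 + ζ ^ m * u ζ}

/-- The (immersed, complete) Riemann surface determined by a function element. -/
def surface (F₀ : FunctionElement) : Set (ℂ × ℂ) :=
  F₀.elementPoints ∪ F₀.algebraicPoints

end FunctionElement

/-! ## Isometries of `X × Y` -/

/-- Componentwise complex conjugation `σ`. -/
def sigma : Equiv.Perm (ℂ × ℂ) :=
  Complex.conjLIE.toEquiv.prodCongr Complex.conjLIE.toEquiv

/-- The rotation `r(θ, φ) : (x, y) ↦ (e ^ (iθ) x, e ^ (iφ) y)`. -/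
def rot (θ φ : ℝ) : Equiv.Perm (ℂ × ℂ) :=
  (rotation (Circle.exp θ)).toEquiv.prodCongr (rotation (Circle.exp φ)).toEquiv

/-- The translation `t(u, v) : (x, y) ↦ (x + u, y + v)`. -/
def translation (w : ℂ × ℂ) : Equiv.Perm (ℂ × ℂ) := Equiv.addRight w

/-- The group of isometries of `X × Y`, generated by `σ`, `r(θ, φ)` and `t(u, v)`. -/
def isometries : Subgroup (Equiv.Perm (ℂ × ℂ)) :=
  Subgroup.closure ({sigma} ∪ Set.range (fun a : ℝ × ℝ => rot a.1 a.2) ∪ Set.range translation)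

open scoped Pointwise in
/-- The isometry group of a surface `S`: the isometries `g` of `X × Y` with `g S = S`. -/
def isometryGroup (S : Set (ℂ × ℂ)) : Subgroup (Equiv.Perm (ℂ × ℂ)) :=
  isometries ⊓ MulAction.stabilizer (Equiv.Perm (ℂ × ℂ)) S

/-- The lattice group of `S`: the translations in its isometry group, written additively, i.e.
identified with the orbit of the origin. -/
def latticeGroup (S : Set (ℂ × ℂ)) : AddSubgroup (ℂ × ℂ) where
  carrier := {w | translation w ∈ isometryGroup S}
  zero_mem' := by
    have h : translation 0 = 1 := by ext z <;> simp [translation]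
    simp [h]
  add_mem' := by
    intro a b ha hb
    have h : translation (a + b) = translation b * translation a := by
      ext z <;> simp [translation, add_assoc]
    simpa [h] using (isometryGroup S).mul_mem hb ha
  neg_mem' := by
    intro a ha
    have h : translation (-a) = (translation a)⁻¹ := by
      rw [eq_inv_iff_mul_eq_one]
      ext z <;> simp [translation]
    simpa [h] using (isometryGroup S).inv_mem ha

/-- The Euclidean inner product of `X × Y = ℝ⁴`. -/
def euclInner (z w : ℂ × ℂ) : ℝ := inner ℝ z.1 w.1 + inner ℝ z.2 w.2

/-- The determinant of the lattice generated by `b 0, …, b 3`: the Gram determinant. -/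
def latticeDet (b : Fin 4 → ℂ × ℂ) : ℝ :=
  (Matrix.of fun i j => euclInner (b i) (b j)).det

/-- `S` is crystallographic: its lattice group `Λ` has rank 4 (it is free abelian on four
generators) and `|Λ| = √(det Λ) > 0`. -/
def IsCrystallographic (S : Set (ℂ × ℂ)) : Prop :=
  ∃ b : Fin 4 → ℂ × ℂ, LinearIndependent ℤ b ∧
    AddSubgroup.closure (Set.range b) = latticeGroup S ∧ 0 < Real.sqrt (latticeDet b)

/-! ## Sections -/

/-- The section `A(x)` of `S` at `x`. -/
def sectionAt (S : Set (ℂ × ℂ)) (x : ℂ) : Set ℂ := Prod.snd '' (S ∩ Prod.fst ⁻¹' {x})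

/-- `S` is finitely discrete: for some `r > 0`, the number of points of `A(x)` in the open disk of
radius `r` about `y` is bounded, uniformly in `x` and `y`. -/
def IsFinitelyDiscrete (S : Set (ℂ × ℂ)) : Prop :=
  ∃ r : ℝ, 0 < r ∧ ∃ N : ℕ, ∀ x y : ℂ, (sectionAt S x ∩ Metric.ball y r).encard ≤ N

/-! ## Triangular graphs -/

/-- The closed triangle with vertices `p 0, p 1, p 2`. -/
def closedTriangle (p : Fin 3 → ℂ) : Set ℂ := convexHull ℝ (Set.range p)

/-- The open triangular region with vertices `p 0, p 1, p 2`. -/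
def openTriangle (p : Fin 3 → ℂ) : Set ℂ := interior (closedTriangle p)

lemma isConnected_openTriangle {p : Fin 3 → ℂ} (hp : AffineIndependent ℝ p) :
    IsConnected (openTriangle p) := by
  refine ⟨?_, (convex_convexHull ℝ _).interior.isPreconnected⟩
  rw [openTriangle, closedTriangle, interior_convexHull_nonempty_iff_affineSpan_eq_top,
    hp.affineSpan_eq_top_iff_card_eq_finrank_add_one]
  simp [Complex.finrank_real_complex]

/-- A triangular graph `P|Q`: the conformal map `f` of the open triangle `P` with vertices `p` onto
the open triangle `Q` with vertices `q` that extends to a homeomorphism of the closures (a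
continuous bijection, as these are compact) taking vertices to vertices. -/
structure TriangularGraph where
  p : Fin 3 → ℂ
  q : Fin 3 → ℂ
  affineIndependent_p : AffineIndependent ℝ p
  affineIndependent_q : AffineIndependent ℝ q
  f : ℂ → ℂ
  differentiableOn_f : DifferentiableOn ℂ f (openTriangle p)
  bijOn_open : Set.BijOn f (openTriangle p) (openTriangle q)
  continuousOn_f : ContinuousOn f (closedTriangle p)
  bijOn_closed : Set.BijOn f (closedTriangle p) (closedTriangle q)
  map_vertex : ∀ i, f (p i) = q i

namespace TriangularGraph

/-- The function element `(P, f)` of a triangular graph. -/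
def element (T : TriangularGraph) : FunctionElement where
  dom := openTriangle T.p
  fn := T.f
  isOpen_dom := isOpen_interior
  isConnected_dom := isConnected_openTriangle T.affineIndependent_p
  differentiableOn_fn := T.differentiableOn_f

/-- The Riemann surface `[P|Q]` determined by a triangular graph. -/
def surface (T : TriangularGraph) : Set (ℂ × ℂ) := T.element.surface

end TriangularGraph

end TriSurf

end

/-! Let Γ (`tileGroup`) be generated by the three pairs (reflection in an edge of P, reflection in
the corresponding edge of Q). By Schwarz reflection, f continues across each open edge, and the
continued graph is the image of the original one under such a pair. Hence Γ maps the surface to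
itself.

Suppose Λ is a genuine lattice. Conjugating a translation in Λ by γ ∈ Γ applies the linear part of γ
to it, so linear parts preserve Λ. They are isometries, and a bounded set contains finitely many
lattice vectors, so only finitely many linear parts occur. Elements with equal linear part differ by
a translation in Λ. Thus the orbit of the origin, counted with multiplicity, is uniformly locally
finite (`hasUniformlyFiniteOrbit`). The tiles, the Γ-images of the closed graph of f, are then
locally finite and their union is closed.

The tiles cover the surface (`surface_subset`). A function element agreeing somewhere with a tile
agrees with tiles on a dense subset of its domain: by local finiteness a limit of tiled points is a
limit of points of a single tile, and reflection continues past it unless it lies over one of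
countably many vertices, which do not disconnect the domain. Closedness then captures all points of
elements, and the branch points as limits of these. Each tile is a graph, so it contributes at most
one point to a section, and the number of tiles near a point is bounded. -/

noncomputable section

namespace TriSurf

open Complex Set Metric Topology
open scoped Interval ComplexConjugate

/-! ## A removability theorem for lines -/

/-- A continuous function that is holomorphic off the real axis is holomorphic. -/
lemma differentiableOn_of_differentiableAt_im_ne_zero {U : Set ℂ} (hU : IsOpen U) {f : ℂ → ℂ}
    (hc : ContinuousOn f U) (hd : ∀ z ∈ U, z.im ≠ 0 → DifferentiableAt ℂ f z) :
    DifferentiableOn ℂ f U := by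
  rw [← isConservativeOn_and_continuousOn_iff_isDifferentiableOn hU]
  refine ⟨fun z w hzw => ?_, hc⟩
  rw [← add_eq_zero_iff_eq_neg, wedgeIntegral_add_wedgeIntegral_eq]
  -- Rectangles whose interior misses the real axis: Cauchy–Goursat needs only continuity on the
  -- boundary.
  have key : ∀ z w : ℂ, [[z.re, w.re]] ×ℂ [[z.im, w.im]] ⊆ U →
      (0 : ℝ) ∉ Ioo (min z.im w.im) (max z.im w.im) →
      (∫ x : ℝ in z.re..w.re, f (x + z.im * I)) - (∫ x : ℝ in z.re..w.re, f (x + w.im * I)) +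
      I • (∫ y : ℝ in z.im..w.im, f (re w + y * I)) -
      I • (∫ y : ℝ in z.im..w.im, f (re z + y * I)) = 0 := by
    intro z w h h0
    refine integral_boundary_rect_eq_zero_of_continuousOn_of_differentiableOn f z w
      (hc.mono h) fun v hv => ?_
    refine (hd v (h ⟨Ioo_subset_Icc_self hv.1, Ioo_subset_Icc_self hv.2⟩) ?_).differentiableWithinAt
    intro hv0
    exact h0 (hv0 ▸ hv.2)
  -- Otherwise the rectangle is cut along the axis; the integrals over the cut cancel and the
  -- vertical sides add up.
  by_cases h0 : (0 : ℝ) ∈ Ioo (min z.im w.im) (max z.im w.im)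
  swap
  · exact key z w hzw h0
  have h0' : (0 : ℝ) ∈ [[z.im, w.im]] := Ioo_subset_Icc_self h0
  have hz' : z.im ∈ [[z.im, w.im]] := left_mem_uIcc
  have hw' : w.im ∈ [[z.im, w.im]] := right_mem_uIcc
  have s1 : [[z.im, 0]] ⊆ [[z.im, w.im]] := uIcc_subset_uIcc hz' h0'
  have s2 : [[0, w.im]] ⊆ [[z.im, w.im]] := uIcc_subset_uIcc h0' hw'
  have k1 := key z (⟨w.re, 0⟩ : ℂ) (fun v hv => hzw ⟨hv.1, s1 hv.2⟩)
    (by simp only [mem_Ioo]; rcases le_total z.im 0 with h | h <;> simp [h])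
  have k2 := key (⟨z.re, 0⟩ : ℂ) w (fun v hv => hzw ⟨hv.1, s2 hv.2⟩)
    (by simp only [mem_Ioo]; rcases le_total w.im 0 with h | h <;> simp [h])
  have hint : ∀ a b c : ℝ, a ∈ [[z.re, w.re]] → b ∈ [[z.im, w.im]] → c ∈ [[z.im, w.im]] →
      IntervalIntegrable (fun y : ℝ => f (a + y * I)) MeasureTheory.volume b c := by
    intro a b c ha hb hcc
    refine ContinuousOn.intervalIntegrable (hc.comp (by fun_prop) fun y hy => hzw ?_)
    have := uIcc_subset_uIcc hb hcc hy
    refine ⟨?_, ?_⟩ <;> simpa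
  have e1 := intervalIntegral.integral_add_adjacent_intervals
    (hint w.re z.im 0 right_mem_uIcc hz' h0') (hint w.re 0 w.im right_mem_uIcc h0' hw')
  have e2 := intervalIntegral.integral_add_adjacent_intervals
    (hint z.re z.im 0 left_mem_uIcc hz' h0') (hint z.re 0 w.im left_mem_uIcc h0' hw')
  rw [← e1, ← e2]
  simp only [smul_add] at k1 k2 ⊢
  linear_combination k1 + k2

/-- A continuous function that is holomorphic off a line is holomorphic. -/
lemma differentiableOn_of_differentiableAt_off_line {U : Set ℂ} (hU : IsOpen U) {f : ℂ → ℂ}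
    {a d : ℂ} (hdne : d ≠ 0) (hc : ContinuousOn f U)
    (hd : ∀ z ∈ U, ((z - a) / d).im ≠ 0 → DifferentiableAt ℂ f z) :
    DifferentiableOn ℂ f U := by
  have h := differentiableOn_of_differentiableAt_im_ne_zero
    (U := (fun t : ℂ => a + d * t) ⁻¹' U) (hU.preimage (by fun_prop))
    (f := fun t => f (a + d * t)) (hc.comp (by fun_prop) fun _ h => h) (by
      intro t ht him
      have : DifferentiableAt ℂ f (a + d * t) := hd _ ht (by
        rwa [add_sub_cancel_left, mul_div_cancel_left₀ _ hdne])
      exact DifferentiableAt.comp t this (by fun_prop))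
  have hcomp : DifferentiableOn ℂ
      ((fun t => f (a + d * t)) ∘ fun z => (z - a) / d) U := by
    refine h.comp (by fun_prop) fun z hz => ?_
    simpa [mul_div_cancel₀ _ hdne] using hz
  refine hcomp.congr fun z _ => ?_
  simp [mul_div_cancel₀ _ hdne]

/-! ## Propagation of density -/

/-- The ball is homeomorphic to the plane, where complements of countable sets are connected. -/
lemma isPreconnected_ball_diff_countable {c : ℂ} {r : ℝ} (hr : 0 < r) {V : Set ℂ}
    (hV : V.Countable) : IsPreconnected (ball c r \ V) := by
  have hpre : ((OpenPartialHomeomorph.univBall c r) ⁻¹' V).Countable := by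
    refine hV.preimage_of_injOn ?_
    have := (OpenPartialHomeomorph.univBall c r).injOn
    rw [OpenPartialHomeomorph.univBall_source] at this
    exact this.mono (subset_univ _)
  have h := (hpre.isConnected_compl_of_one_lt_rank (by simp)).isPreconnected.image _
    (OpenPartialHomeomorph.continuous_univBall c r).continuousOn
  convert h using 1
  ext z
  constructor
  · rintro ⟨hz, hzV⟩
    rw [← OpenPartialHomeomorph.univBall_target c hr] at hz
    have := (OpenPartialHomeomorph.univBall c r).right_inv hz
    exact ⟨_, by simpa [this] using hzV, this⟩
  · rintro ⟨t, ht, rfl⟩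
    refine ⟨?_, ht⟩
    rw [← OpenPartialHomeomorph.univBall_target c hr]
    exact (OpenPartialHomeomorph.univBall c r).map_source (by simp)

/-- If the closure of an open set `E` is a neighbourhood of each of its points in `U`, with
countably many exceptions, then `E` is dense in `U` or disjoint from it. -/
lemma subset_closure_of_closure_mem_nhds {U E V : Set ℂ} (hU : IsOpen U) (hUc : IsPreconnected U)
    (hE : IsOpen E) (hV : V.Countable) (hne : (U ∩ E).Nonempty)
    (h : ∀ x ∈ U, x ∉ V → x ∈ closure E → closure E ∈ 𝓝 x) : U ⊆ closure E := by
  have hsub : E ⊆ interior (closure E) := hE.subset_interior_closure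
  have hcl : closure (interior (closure E)) ⊆ closure E :=
    closure_minimal interior_subset isClosed_closure
  suffices U ⊆ interior (closure E) from this.trans interior_subset
  refine hUc.subset_of_closure_inter_subset isOpen_interior
    (hne.mono (inter_subset_inter_right _ hsub)) ?_
  rintro x ⟨hx, hxU⟩
  obtain ⟨r, hr, hball⟩ := Metric.isOpen_iff.1 hU x hxU
  have hdense : Dense Vᶜ := hV.dense_compl ℝ
  -- Nothing is known at points of `V`, so the connectedness argument is run on the ball without
  -- `V`; density of the complement of `V` then recovers the whole ball.
  have hW : ball x r \ V ⊆ interior (closure E) := by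
    refine (isPreconnected_ball_diff_countable hr hV).subset_of_closure_inter_subset
      isOpen_interior ?_ ?_
    · obtain ⟨y, hyE, hy⟩ := Metric.mem_closure_iff.1 (hcl hx) r hr
      obtain ⟨z, hz, hzV⟩ := hdense.inter_open_nonempty (ball x r ∩ E) (isOpen_ball.inter hE)
        ⟨y, by rwa [mem_ball, dist_comm], hyE⟩
      exact ⟨z, ⟨hz.1, hzV⟩, hsub hz.2⟩
    · rintro y ⟨hy, hyb, hyV⟩
      exact mem_interior_iff_mem_nhds.2 (h y (hball hyb) hyV (hcl hy))
  rw [mem_interior_iff_mem_nhds]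
  refine Filter.mem_of_superset (ball_mem_nhds x hr) ?_
  calc ball x r ⊆ closure (ball x r ∩ Vᶜ) := hdense.open_subset_closure_inter isOpen_ball
    _ ⊆ closure E := closure_minimal (hW.trans interior_subset) isClosed_closure

/-! ## Reflections in lines -/

lemma norm_div_conj {d : ℂ} (hd : d ≠ 0) : ‖d / conj d‖ = 1 := by
  rw [norm_div, RCLike.norm_conj, div_self (norm_ne_zero_iff.2 hd)]

/-- The reflection in the line through `a` and `b`. -/
def lineReflection (a b : ℂ) (h : a ≠ b) : ℂ ≃ᵢ ℂ :=
  IsometryEquiv.mk' (fun z => a + (b - a) / conj (b - a) * conj (z - a))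
    (fun z => a + (b - a) / conj (b - a) * conj (z - a))
    (by
      intro z
      have h1 : b - a ≠ 0 := sub_ne_zero.2 h.symm
      have h2 : conj (b - a) ≠ 0 := (map_ne_zero _).2 h1
      simp only [add_sub_cancel_left, map_mul, map_div₀, Complex.conj_conj]
      field_simp
      ring)
    (by
      refine Isometry.of_dist_eq fun z w => ?_
      have h1 : b - a ≠ 0 := sub_ne_zero.2 h.symm
      rw [dist_add_left, dist_eq_norm, ← mul_sub, norm_mul, norm_div_conj h1, one_mul,
        ← map_sub, RCLike.norm_conj, sub_sub_sub_cancel_right, dist_eq_norm])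

lemma lineReflection_apply {a b : ℂ} (h : a ≠ b) (z : ℂ) :
    lineReflection a b h z = a + (b - a) / conj (b - a) * conj (z - a) := rfl

lemma lineReflection_lineMap {a b : ℂ} (h : a ≠ b) (t : ℝ) :
    lineReflection a b h (AffineMap.lineMap a b t) = AffineMap.lineMap a b t := by
  have h2 : conj b - conj a ≠ 0 := by
    rw [← map_sub]
    exact (map_ne_zero _).2 (sub_ne_zero.2 h.symm)
  simp only [lineReflection_apply, AffineMap.lineMap_apply, vsub_eq_sub, vadd_eq_add, real_smul,
    add_sub_cancel_right, map_mul, map_sub, conj_ofReal]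
  field_simp
  ring

/-- The midpoint is the foot of the perpendicular. Consequently an affine function vanishing on the
line changes sign under the reflection. -/
lemma exists_midpoint_lineReflection {a b : ℂ} (h : a ≠ b) (z : ℂ) :
    ∃ t : ℝ, midpoint ℝ z (lineReflection a b h z) = AffineMap.lineMap a b t := by
  refine ⟨((z - a) / (b - a)).re, ?_⟩
  have h1 : b - a ≠ 0 := sub_ne_zero.2 h.symm
  have h2 : conj b - conj a ≠ 0 := by
    rw [← map_sub]
    exact (map_ne_zero _).2 h1
  simp only [lineReflection_apply, AffineMap.lineMap_apply, vsub_eq_sub, vadd_eq_add, real_smul,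
    midpoint_eq_smul_add, re_eq_add_conj, map_div₀, map_sub, invOf_eq_inv, ofReal_inv, ofReal_ofNat]
  field_simp
  ring

/-- Reflecting both the argument and the value preserves holomorphy. -/
lemma differentiableAt_lineReflection_comp {a b a' b' : ℂ} (h : a ≠ b) (h' : a' ≠ b')
    {g : ℂ → ℂ} {z : ℂ} (hg : DifferentiableAt ℂ g (lineReflection a b h z)) :
    DifferentiableAt ℂ (fun z => lineReflection a' b' h' (g (lineReflection a b h z))) z := by
  -- A reflection is a complex affine map after conjugation, so the composite is affine ∘ (conj ∘
  -- holomorphic ∘ conj).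
  have key : DifferentiableAt ℂ
      (fun w => g (a + (b - a) / conj (b - a) * (w - conj a))) (conj z) := by
    refine DifferentiableAt.comp (g := g) (conj z) ?_ (by fun_prop)
    simpa [lineReflection_apply] using hg
  have key2 := (key.conj_conj)
  rw [Complex.conj_conj] at key2
  have key3 : DifferentiableAt ℂ (fun w => a' + (b' - a') / conj (b' - a') *
      (((conj : ℂ → ℂ) ∘ (fun w => g (a + (b - a) / conj (b - a) * (w - conj a))) ∘ conj) w
        - conj a')) z := by fun_prop
  convert key3 using 2 with w
  simp [lineReflection_apply]

/-! ## Barycentric coordinates -/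

section Triangle

variable {p : Fin 3 → ℂ} (hp : AffineIndependent ℝ p)

/-- The vertices of a nondegenerate triangle as an affine basis of the plane. -/
def triangleBasis (hp : AffineIndependent ℝ p) : AffineBasis (Fin 3) ℝ ℂ :=
  ⟨p, hp, by
    rw [hp.affineSpan_eq_top_iff_card_eq_finrank_add_one]
    simp [Complex.finrank_real_complex]⟩

/-- The barycentric coordinates with respect to a triangle. -/
def bary (hp : AffineIndependent ℝ p) (k : Fin 3) : ℂ →ᵃ[ℝ] ℝ := (triangleBasis hp).coord k

include hp

lemma bary_self (k : Fin 3) : bary hp k (p k) = 1 := (triangleBasis hp).coord_apply_eq k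

lemma bary_ne {k j : Fin 3} (h : k ≠ j) : bary hp k (p j) = 0 :=
  (triangleBasis hp).coord_apply_ne h

lemma continuous_bary (k : Fin 3) : Continuous (bary hp k) :=
  continuous_barycentric_coord (triangleBasis hp) k

lemma sum_bary (z : ℂ) : ∑ k, bary hp k z = 1 := (triangleBasis hp).sum_coord_apply_eq_one z

lemma sum_bary_smul (z : ℂ) : ∑ k, bary hp k z • p k = z :=
  (triangleBasis hp).linear_combination_coord_eq_self z

lemma mem_closedTriangle_iff {z : ℂ} : z ∈ closedTriangle p ↔ ∀ k, 0 ≤ bary hp k z := by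
  change z ∈ convexHull ℝ (range (triangleBasis hp)) ↔ _
  rw [AffineBasis.convexHull_eq_nonneg_coord]
  rfl

lemma mem_openTriangle_iff {z : ℂ} : z ∈ openTriangle p ↔ ∀ k, 0 < bary hp k z := by
  change z ∈ interior (convexHull ℝ (range (triangleBasis hp))) ↔ _
  rw [AffineBasis.interior_convexHull]
  rfl

omit hp in
lemma vertex_mem_closedTriangle (k : Fin 3) : p k ∈ closedTriangle p :=
  subset_convexHull ℝ _ (mem_range_self k)

omit hp in
lemma fin_three_ne (k : Fin 3) : k + 1 ≠ k + 2 ∧ k ≠ k + 1 ∧ k ≠ k + 2 := by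
  revert k; decide

omit hp in
lemma sum_fin_three {M : Type*} [AddCommMonoid M] (f : Fin 3 → M) (k : Fin 3) :
    ∑ i, f i = f k + f (k + 1) + f (k + 2) := by
  rw [Fin.sum_univ_three]
  fin_cases k
  · rfl
  · change f 0 + f 1 + f 2 = f 1 + f 2 + f 0
    abel
  · change f 0 + f 1 + f 2 = f 2 + f 0 + f 1
    abel

lemma vertex_ne (k : Fin 3) : p (k + 1) ≠ p (k + 2) :=
  fun h => (fin_three_ne k).1 (hp.injective h)

lemma bary_lineMap_edge (k : Fin 3) (t : ℝ) :
    bary hp k (AffineMap.lineMap (p (k + 1)) (p (k + 2)) t) = 0 := by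
  rw [AffineMap.apply_lineMap, bary_ne hp (fin_three_ne k).2.1, bary_ne hp (fin_three_ne k).2.2]
  simp

lemma eq_lineMap_of_bary_eq_zero {k : Fin 3} {z : ℂ} (h : bary hp k z = 0) :
    z = AffineMap.lineMap (p (k + 1)) (p (k + 2)) (bary hp (k + 2) z) := by
  have h1 := sum_bary hp z
  have h2 := sum_bary_smul hp z
  rw [sum_fin_three _ k, h] at h1 h2
  have h3 : bary hp (k + 1) z = 1 - bary hp (k + 2) z := by linarith
  rw [h3] at h2
  rw [AffineMap.lineMap_apply_module]
  simpa using h2.symm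

lemma eq_vertex_of_bary_eq_zero {k j : Fin 3} (hkj : k ≠ j) {z : ℂ} (hk : bary hp k z = 0)
    (hj : bary hp j z = 0) : ∃ i, z = p i := by
  have hj' : j = k + 1 ∨ j = k + 2 := by
    clear hk hj
    revert k j; decide
  have h2 := sum_bary_smul hp z
  have h1 := sum_bary hp z
  rw [sum_fin_three _ k, hk] at h1 h2
  rcases hj' with rfl | rfl
  · refine ⟨k + 2, ?_⟩
    rw [hj] at h1 h2
    have : bary hp (k + 2) z = 1 := by linarith
    simpa [this] using h2.symm
  · refine ⟨k + 1, ?_⟩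
    rw [hj] at h1 h2
    have : bary hp (k + 1) z = 1 := by linarith
    simpa [this] using h2.symm

/-- The reflection in the edge opposite to the vertex `p k`. -/
def edgeReflection (k : Fin 3) : ℂ ≃ᵢ ℂ :=
  lineReflection (p (k + 1)) (p (k + 2)) (vertex_ne hp k)

lemma bary_edgeReflection (k : Fin 3) (z : ℂ) :
    bary hp k (edgeReflection hp k z) = -bary hp k z := by
  obtain ⟨t, ht⟩ := exists_midpoint_lineReflection (vertex_ne hp k) z
  have h := congrArg (bary hp k) ht
  rw [bary_lineMap_edge, AffineMap.map_midpoint, midpoint_eq_smul_add, smul_eq_mul] at h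
  have h' : bary hp k z + bary hp k (edgeReflection hp k z) = 0 := by
    simpa [edgeReflection] using h
  linarith

lemma edgeReflection_of_bary_eq_zero {k : Fin 3} {z : ℂ} (h : bary hp k z = 0) :
    edgeReflection hp k z = z := by
  rw [eq_lineMap_of_bary_eq_zero hp h]
  exact lineReflection_lineMap _ _

lemma dense_bary_ne_zero (k : Fin 3) : Dense {z | bary hp k z ≠ 0} := by
  intro z
  by_cases hz : bary hp k z = 0
  swap
  · exact subset_closure hz
  have hc : ContinuousAt (fun t : ℝ => AffineMap.lineMap z (p k) t) 0 := by
    have : Continuous (fun t : ℝ => AffineMap.lineMap z (p k) t) :=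
      AffineMap.lineMap_continuous
    exact this.continuousAt
  have hc' : Filter.Tendsto (fun t : ℝ => AffineMap.lineMap z (p k) t) (𝓝[≠] 0) (𝓝 z) := by
    simpa using hc.tendsto.mono_left (nhdsWithin_le_nhds (s := {0}ᶜ))
  refine mem_closure_of_tendsto hc' ?_
  filter_upwards [self_mem_nhdsWithin] with t ht
  rw [AffineMap.apply_lineMap, hz, bary_self hp, AffineMap.lineMap_apply]
  simpa using ht

/-- The open edge opposite to the vertex `p k`. -/
def openEdge (k : Fin 3) : Set ℂ := {z | bary hp k z = 0 ∧ ∀ j, j ≠ k → 0 < bary hp j z}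

lemma openEdge_subset (k : Fin 3) : openEdge hp k ⊆ closedTriangle p := by
  rintro z ⟨h1, h2⟩
  rw [mem_closedTriangle_iff hp]
  intro j
  by_cases hj : j = k
  · rw [hj, h1]
  · exact (h2 j hj).le

lemma isPreconnected_openEdge (k : Fin 3) : IsPreconnected (openEdge hp k) := by
  have : openEdge hp k = bary hp k ⁻¹' {0} ∩ ⋂ (j) (_ : j ≠ k), bary hp j ⁻¹' Ioi 0 := by
    ext z
    simp [openEdge]
  rw [this]
  exact (((convex_singleton 0).affine_preimage _).inter
    (convex_iInter₂ fun j _ => (convex_Ioi 0).affine_preimage _)).isPreconnected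

lemma vertex_mem_closure_openEdge {k j : Fin 3} (h : j ≠ k) : p j ∈ closure (openEdge hp k) := by
  obtain ⟨i, hik, hij, hall⟩ : ∃ i : Fin 3, i ≠ k ∧ i ≠ j ∧ ∀ l, l ≠ k → l = j ∨ l = i := by
    revert k j; decide
  have hsub : openSegment ℝ (p j) (p i) ⊆ openEdge hp k := by
    rw [openSegment_eq_image_lineMap]
    rintro _ ⟨t, ht, rfl⟩
    refine ⟨?_, fun l hl => ?_⟩
    · rw [AffineMap.apply_lineMap, bary_ne hp h.symm, bary_ne hp hik.symm]
      simp
    · rw [AffineMap.apply_lineMap, AffineMap.lineMap_apply_module]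
      rcases hall l hl with rfl | rfl
      · rw [bary_self, bary_ne hp hij.symm]
        simpa using ht.2
      · rw [bary_self, bary_ne hp hij]
        simpa using ht.1
  refine closure_mono hsub ?_
  rw [closure_openSegment]
  exact left_mem_segment ℝ _ _

omit hp in
lemma isCompact_closedTriangle : IsCompact (closedTriangle p) :=
  (Set.finite_range p).isCompact_convexHull ℝ

end Triangle

/-! ## Boundary behaviour of a triangular graph -/

namespace TriangularGraph

variable (T : TriangularGraph)

/-- The boundary goes to the boundary: an interior value is already attained in the open triangle,
against injectivity on the closed one. -/
lemma exists_bary_f_eq_zero {z : ℂ} (hz : z ∈ closedTriangle T.p)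
    (hz' : z ∉ openTriangle T.p) : ∃ j, bary T.affineIndependent_q j (T.f z) = 0 := by
  by_contra! h
  have h1 := (mem_closedTriangle_iff T.affineIndependent_q).1 (T.bijOn_closed.mapsTo hz)
  have h2 : T.f z ∈ openTriangle T.q :=
    (mem_openTriangle_iff T.affineIndependent_q).2 fun k => (h1 k).lt_of_ne (h k).symm
  obtain ⟨w, hw, hwz⟩ := T.bijOn_open.surjOn h2
  exact hz' (T.bijOn_closed.injOn (interior_subset hw) hz hwz ▸ hw)

/-- The image of an open edge is connected and lies in the boundary of Q without its vertices, hence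
in one open edge. It accumulates at `T.q j` for each `j ≠ k`, which excludes the edge opposite `T.q
j`. -/
lemma f_mem_openEdge {k : Fin 3} {z : ℂ} (hz : z ∈ openEdge T.affineIndependent_p k) :
    T.f z ∈ openEdge T.affineIndependent_q k := by
  set hp := T.affineIndependent_p
  set hq := T.affineIndependent_q
  have hnot : ∀ w ∈ openEdge hp k, w ∉ openTriangle T.p := fun w hw h =>
    ((mem_openTriangle_iff hp).1 h k).ne' hw.1
  have hnv : ∀ w ∈ openEdge hp k, ∀ i, T.f w ≠ T.q i := by
    intro w hw i hi
    rw [← T.map_vertex] at hi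
    have hwi := T.bijOn_closed.injOn (openEdge_subset hp k hw) (vertex_mem_closedTriangle i) hi
    obtain ⟨l, hlk, hli⟩ : ∃ l : Fin 3, l ≠ k ∧ l ≠ i := by
      clear * -
      revert k i; decide
    have := hw.2 l hlk
    rw [hwi, bary_ne hp hli] at this
    exact this.ne rfl
  have hpos : ∀ w ∈ openEdge hp k, ∀ i j, i ≠ j → bary hq j (T.f w) = 0 →
      0 < bary hq i (T.f w) := by
    intro w hw i j hij h0
    refine ((mem_closedTriangle_iff hq).1
      (T.bijOn_closed.mapsTo (openEdge_subset hp k hw)) i).lt_of_ne fun h => ?_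
    obtain ⟨l, hl⟩ := eq_vertex_of_bary_eq_zero hq hij h.symm h0
    exact hnv w hw l hl
  have hcont : ContinuousOn T.f (openEdge hp k) := T.continuousOn_f.mono (openEdge_subset hp k)
  have hconn := (isPreconnected_openEdge hp k).image _ hcont
  have main : ∀ j, j ≠ k → ∀ w ∈ openEdge hp k, 0 < bary hq j (T.f w) := by
    intro j hj
    -- On the image the first open set cuts out edge `j`, the second the other two edges.
    have hsplit := isPreconnected_iff_subset_of_disjoint.1 hconn
      (⋂ (i) (_ : i ≠ j), bary hq i ⁻¹' Ioi 0) (bary hq j ⁻¹' Ioi 0)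
      (isOpen_iInter_of_finite fun i => isOpen_iInter_of_finite fun _ =>
        isOpen_Ioi.preimage (continuous_bary hq i))
      (isOpen_Ioi.preimage (continuous_bary hq j)) ?_ ?_
    · rcases hsplit with h | h
      · exfalso
        have hzero : ∀ w ∈ openEdge hp k, bary hq j (T.f w) = 0 := by
          intro w hw
          obtain ⟨l, hl⟩ := T.exists_bary_f_eq_zero (openEdge_subset hp k hw) (hnot w hw)
          by_cases hlj : l = j
          · exact hlj ▸ hl
          · have := h (mem_image_of_mem _ hw)
            simp only [mem_iInter, mem_preimage, mem_Ioi] at this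
            exact absurd hl (this l hlj).ne'
        have hcl := vertex_mem_closure_openEdge hp hj
        have hcw : ContinuousWithinAt (fun w => bary hq j (T.f w)) (openEdge hp k) (T.p j) :=
          (continuous_bary hq j).continuousAt.comp_continuousWithinAt
            ((T.continuousOn_f _ (vertex_mem_closedTriangle j)).mono (openEdge_subset hp k))
        have := hcw.mem_closure (t := {0}) hcl fun w hw => hzero w hw
        rw [closure_singleton, mem_singleton_iff, T.map_vertex, bary_self] at this
        exact one_ne_zero this
      · exact fun w hw => h (mem_image_of_mem _ hw)
    · rintro _ ⟨w, hw, rfl⟩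
      obtain ⟨l, hl⟩ := T.exists_bary_f_eq_zero (openEdge_subset hp k hw) (hnot w hw)
      by_cases hlj : l = j
      · left
        simp only [mem_iInter, mem_preimage, mem_Ioi]
        exact fun i hi => hpos w hw i j hi (hlj ▸ hl)
      · right
        exact hpos w hw j l (Ne.symm hlj) hl
    · ext v
      simp only [mem_inter_iff, mem_iInter, mem_preimage, mem_Ioi, mem_empty_iff_false, iff_false]
      rintro ⟨⟨w, hw, rfl⟩, h1, h2⟩
      obtain ⟨l, hl⟩ := T.exists_bary_f_eq_zero (openEdge_subset hp k hw) (hnot w hw)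
      by_cases hlj : l = j
      · exact h2.ne' (hlj ▸ hl)
      · exact (h1 l hlj).ne' hl
  refine ⟨?_, fun j hj => main j hj z hz⟩
  obtain ⟨l, hl⟩ := T.exists_bary_f_eq_zero (openEdge_subset hp k hz) (hnot z hz)
  by_cases hlk : l = k
  · exact hlk ▸ hl
  · exact absurd hl (main l hlk z hz).ne'

end TriangularGraph

/-! ## Schwarz reflection -/

namespace TriangularGraph

variable (T : TriangularGraph)

/-- The pair of reflections in corresponding edges of the two triangles. -/
def edgePair (k : Fin 3) : (ℂ ≃ᵢ ℂ) × (ℂ ≃ᵢ ℂ) :=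
  (edgeReflection T.affineIndependent_p k, edgeReflection T.affineIndependent_q k)

/-- The extension of `f` across the edge opposite to the vertex `p k` by reflection. -/
def schwarz (k : Fin 3) (z : ℂ) : ℂ :=
  if 0 ≤ bary T.affineIndependent_p k z then T.f z
  else (T.edgePair k).2 (T.f ((T.edgePair k).1 z))

/-- Definitional, because each reflection is constructed with itself as inverse. -/
lemma edgePair_inv (k : Fin 3) : (T.edgePair k)⁻¹ = T.edgePair k := rfl

variable {T}

lemma schwarz_of_nonneg {k : Fin 3} {z : ℂ} (h : 0 ≤ bary T.affineIndependent_p k z) :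
    T.schwarz k z = T.f z := if_pos h

lemma schwarz_of_neg {k : Fin 3} {z : ℂ} (h : bary T.affineIndependent_p k z < 0) :
    T.schwarz k z = (T.edgePair k).2 (T.f ((T.edgePair k).1 z)) := if_neg h.not_ge

lemma schwarz_eventuallyEq_of_pos {k : Fin 3} {z : ℂ} (h : 0 < bary T.affineIndependent_p k z) :
    T.schwarz k =ᶠ[𝓝 z] T.f := by
  filter_upwards [(continuous_bary T.affineIndependent_p k).continuousAt.eventually (lt_mem_nhds h)]
    with w hw using schwarz_of_nonneg hw.le

lemma schwarz_eventuallyEq_of_neg {k : Fin 3} {z : ℂ} (h : bary T.affineIndependent_p k z < 0) :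
    T.schwarz k =ᶠ[𝓝 z] fun w => (T.edgePair k).2 (T.f ((T.edgePair k).1 w)) := by
  filter_upwards [(continuous_bary T.affineIndependent_p k).continuousAt.eventually (gt_mem_nhds h)]
    with w hw using schwarz_of_neg hw

/-- On the edge both branches agree: the reflections fix `z` and, by `f_mem_openEdge`, also `T.f z`.
-/
lemma schwarz_of_nonpos_of_mem {k : Fin 3} {z : ℂ}
    (hz : bary T.affineIndependent_p k z < 0 ∨ z ∈ openEdge T.affineIndependent_p k) :
    T.schwarz k z = (T.edgePair k).2 (T.f ((T.edgePair k).1 z)) := by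
  rcases hz with h | h
  · exact schwarz_of_neg h
  · rw [schwarz_of_nonneg h.1.ge]
    simp only [edgePair]
    rw [edgeReflection_of_bary_eq_zero _ h.1,
      edgeReflection_of_bary_eq_zero _ (T.f_mem_openEdge h).1]

/-- Near a point of an open edge, the extension by reflection is holomorphic. -/
lemma exists_ball_differentiableOn_schwarz {k : Fin 3} {x : ℂ}
    (hx : x ∈ openEdge T.affineIndependent_p k) :
    ∃ r > 0, DifferentiableOn ℂ (T.schwarz k) (ball x r) ∧ ∀ z ∈ ball x r,
      (T.edgePair k).1 z ∈ ball x r ∧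
      (0 < bary T.affineIndependent_p k z → z ∈ openTriangle T.p) ∧
      (bary T.affineIndependent_p k z < 0 → (T.edgePair k).1 z ∈ openTriangle T.p) := by
  set hp := T.affineIndependent_p
  have hopen : IsOpen (⋂ (j) (_ : j ≠ k), bary hp j ⁻¹' Ioi 0) :=
    isOpen_iInter_of_finite fun i => isOpen_iInter_of_finite fun _ =>
        isOpen_Ioi.preimage (continuous_bary hp i)
  -- In this ball the other two coordinates stay positive, so the sign of the `k`-th one alone
  -- decides membership in the triangle.
  obtain ⟨r, hr, hball⟩ := Metric.isOpen_iff.1 hopen x (by simpa using hx.2)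
  replace hball : ∀ z ∈ ball x r, ∀ j, j ≠ k → 0 < bary hp j z := by
    intro z hz
    simpa using hball hz
  have hrefl : ∀ z ∈ ball x r, (T.edgePair k).1 z ∈ ball x r := by
    intro z hz
    have hfix : (T.edgePair k).1 x = x := edgeReflection_of_bary_eq_zero hp hx.1
    rw [mem_ball]
    calc dist ((T.edgePair k).1 z) x = dist ((T.edgePair k).1 z) ((T.edgePair k).1 x) := by
          rw [hfix]
      _ = dist z x := (T.edgePair k).1.dist_eq _ _
      _ < r := hz
  have hpos : ∀ z ∈ ball x r, 0 < bary hp k z → z ∈ openTriangle T.p := by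
    intro z hz h
    rw [mem_openTriangle_iff hp]
    intro j
    by_cases hj : j = k
    · rwa [hj]
    · exact hball z hz j hj
  have hneg : ∀ z ∈ ball x r, bary hp k z < 0 → (T.edgePair k).1 z ∈ openTriangle T.p := by
    intro z hz h
    refine hpos _ (hrefl z hz) ?_
    change 0 < bary hp k (edgeReflection hp k z)
    rw [bary_edgeReflection]
    linarith
  have hdf : ∀ z ∈ openTriangle T.p, DifferentiableAt ℂ T.f z := fun z hz =>
    T.differentiableOn_f.differentiableAt (isOpen_interior.mem_nhds hz)
  have hd : ∀ z ∈ ball x r, bary hp k z ≠ 0 → DifferentiableAt ℂ (T.schwarz k) z := by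
    intro z hz h
    rcases lt_or_gt_of_ne h with h | h
    · exact (differentiableAt_lineReflection_comp (vertex_ne hp k)
        (vertex_ne T.affineIndependent_q k) (hdf _ (hneg z hz h))).congr_of_eventuallyEq
        (schwarz_eventuallyEq_of_neg h)
    · exact (hdf z (hpos z hz h)).congr_of_eventuallyEq (schwarz_eventuallyEq_of_pos h)
  have hclosed : ∀ z ∈ ball x r, 0 ≤ bary hp k z → z ∈ closedTriangle T.p := by
    intro z hz h
    rw [mem_closedTriangle_iff hp]
    intro j
    by_cases hj : j = k
    · rwa [hj]
    · exact (hball z hz j hj).le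
  have hc : ContinuousOn (T.schwarz k) (ball x r) := by
    intro z hz
    refine ContinuousAt.continuousWithinAt ?_
    by_cases h0 : bary hp k z = 0
    swap
    · exact (hd z hz h0).continuousAt
    have hnhds : ball x r ∈ 𝓝 z := isOpen_ball.mem_nhds hz
    -- At points of the edge, continuity is checked on the two closed sides separately.
    have c1 : ContinuousWithinAt (T.schwarz k) ({w | 0 ≤ bary hp k w} ∩ ball x r) z :=
      ((T.continuousOn_f z (hclosed z hz h0.ge)).mono fun w hw => hclosed w hw.2 hw.1).congr
        (fun w hw => schwarz_of_nonneg hw.1) (schwarz_of_nonneg h0.ge)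
    have hmaps : MapsTo (T.edgePair k).1 ({w | bary hp k w ≤ 0} ∩ ball x r)
        (closedTriangle T.p) := by
      rintro w ⟨hw, hwb⟩
      refine hclosed _ (hrefl w hwb) ?_
      change 0 ≤ bary hp k (edgeReflection hp k w)
      rw [bary_edgeReflection]
      simpa using hw
    have hform : ∀ w ∈ {w | bary hp k w ≤ 0} ∩ ball x r,
        T.schwarz k w = (T.edgePair k).2 (T.f ((T.edgePair k).1 w)) := by
      rintro w ⟨hw, hwb⟩
      refine schwarz_of_nonpos_of_mem ?_
      rcases (show bary hp k w ≤ 0 from hw).lt_or_eq with h | h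
      · exact Or.inl h
      · exact Or.inr ⟨h, hball w hwb⟩
    have hzm : z ∈ {w | bary hp k w ≤ 0} ∩ ball x r := ⟨h0.le, hz⟩
    have c2 : ContinuousWithinAt (T.schwarz k) ({w | bary hp k w ≤ 0} ∩ ball x r) z := by
      refine ContinuousWithinAt.congr ?_ hform (hform z hzm)
      exact (T.edgePair k).2.continuous.continuousAt.comp_continuousWithinAt
        ((T.continuousOn_f _ (hmaps hzm)).comp
          (T.edgePair k).1.continuous.continuousWithinAt hmaps)
    refine (c1.union c2).continuousAt (Filter.mem_of_superset hnhds fun w hw => ?_)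
    rcases le_total 0 (bary hp k w) with h | h
    · exact Or.inl ⟨h, hw⟩
    · exact Or.inr ⟨h, hw⟩
  refine ⟨r, hr, ?_, fun z hz => ⟨hrefl z hz, hpos z hz, hneg z hz⟩⟩
  have hdne : T.p (k + 2) - T.p (k + 1) ≠ 0 := sub_ne_zero.2 (vertex_ne hp k).symm
  refine differentiableOn_of_differentiableAt_off_line (a := T.p (k + 1)) isOpen_ball hdne hc
    fun z hz him => hd z hz fun h0 => him ?_
  rw [eq_lineMap_of_bary_eq_zero hp h0, AffineMap.lineMap_apply, vsub_eq_sub, vadd_eq_add,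
    add_sub_cancel_right, real_smul, mul_div_cancel_right₀ _ hdne, ofReal_im]

end TriangularGraph

/-! ## The action on function elements -/

/-- The action of a pair of isometries on `ℂ × ℂ`. -/
def act (γ : (ℂ ≃ᵢ ℂ) × (ℂ ≃ᵢ ℂ)) (z : ℂ × ℂ) : ℂ × ℂ := (γ.1 z.1, γ.2 z.2)

lemma act_mul (γ γ' : (ℂ ≃ᵢ ℂ) × (ℂ ≃ᵢ ℂ)) (z : ℂ × ℂ) : act (γ * γ') z = act γ (act γ' z) := rfl

lemma act_one (z : ℂ × ℂ) : act 1 z = z := rfl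

lemma act_inv_act (γ : (ℂ ≃ᵢ ℂ) × (ℂ ≃ᵢ ℂ)) (z : ℂ × ℂ) : act γ⁻¹ (act γ z) = z := by
  rw [← act_mul, inv_mul_cancel, act_one]

lemma act_act_inv (γ : (ℂ ≃ᵢ ℂ) × (ℂ ≃ᵢ ℂ)) (z : ℂ × ℂ) : act γ (act γ⁻¹ z) = z := by
  rw [← act_mul, mul_inv_cancel, act_one]

lemma dist_act (γ : (ℂ ≃ᵢ ℂ) × (ℂ ≃ᵢ ℂ)) (z w : ℂ × ℂ) : dist (act γ z) (act γ w) = dist z w := by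
  simp only [act, Prod.dist_eq, IsometryEquiv.dist_eq]

/-- A pair of isometries is conformal if it maps graphs of holomorphic functions to graphs of
holomorphic functions. -/
def IsConformalPair (γ : (ℂ ≃ᵢ ℂ) × (ℂ ≃ᵢ ℂ)) : Prop :=
  ∀ (g : ℂ → ℂ) (x : ℂ), DifferentiableAt ℂ g (γ.1.symm x) →
    DifferentiableAt ℂ (fun z => γ.2 (g (γ.1.symm z))) x

lemma IsConformalPair.mul {γ γ' : (ℂ ≃ᵢ ℂ) × (ℂ ≃ᵢ ℂ)} (h : IsConformalPair γ)
    (h' : IsConformalPair γ') : IsConformalPair (γ * γ') :=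
  fun g _ hg => h (fun z => γ'.2 (g (γ'.1.symm z))) _ (h' g _ hg)

namespace FunctionElement

/-- The image of a function element under a conformal pair of isometries. -/
def transport (γ : (ℂ ≃ᵢ ℂ) × (ℂ ≃ᵢ ℂ)) (hγ : IsConformalPair γ) (F : FunctionElement) :
    FunctionElement where
  dom := γ.1.symm ⁻¹' F.dom
  fn := fun z => γ.2 (F.fn (γ.1.symm z))
  isOpen_dom := F.isOpen_dom.preimage γ.1.symm.continuous
  isConnected_dom := by
    rw [← IsometryEquiv.image_symm, IsometryEquiv.symm_symm]
    exact F.isConnected_dom.image _ γ.1.continuous.continuousOn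
  differentiableOn_fn := fun z hz =>
    (hγ F.fn z (F.differentiableOn_fn.differentiableAt
      (F.isOpen_dom.mem_nhds hz))).differentiableWithinAt

variable {γ : (ℂ ≃ᵢ ℂ) × (ℂ ≃ᵢ ℂ)} {hγ : IsConformalPair γ}

lemma IsDirectContinuation.transport {F₁ F₂ : FunctionElement} (h : IsDirectContinuation F₁ F₂) :
    IsDirectContinuation (F₁.transport γ hγ) (F₂.transport γ hγ) := by
  obtain ⟨⟨x, hx⟩, heq⟩ := h
  refine ⟨⟨γ.1 x, ?_⟩, fun z hz => congrArg γ.2 (heq hz)⟩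
  simpa [FunctionElement.transport] using hx

/-- The image under `γ` of a chain from `F₀` to `F` is appended to a chain from `F₀` to its own
image. -/
lemma transport_mem_globalFunction {F₀ F : FunctionElement}
    (h₀ : F₀.transport γ hγ ∈ F₀.globalFunction) (hF : F ∈ F₀.globalFunction) :
    F.transport γ hγ ∈ F₀.globalFunction :=
  Relation.ReflTransGen.trans h₀
    (Relation.ReflTransGen.lift (r := IsDirectContinuation)
      (fun F : FunctionElement => F.transport γ hγ) (fun _ _ h => h.transport) _ _ hF)

end FunctionElement

namespace TriangularGraph

variable (T : TriangularGraph)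

/-- The group generated by the reflections in the edges. -/
def tileGroup : Subgroup ((ℂ ≃ᵢ ℂ) × (ℂ ≃ᵢ ℂ)) := Subgroup.closure (range T.edgePair)

variable {T}

lemma edgePair_mem (k : Fin 3) : T.edgePair k ∈ T.tileGroup :=
  Subgroup.subset_closure (mem_range_self k)

/-- The generators are involutions, so inverses need no separate case. -/
lemma tileGroup_induction {P : (ℂ ≃ᵢ ℂ) × (ℂ ≃ᵢ ℂ) → Prop} (one : P 1)
    (mul : ∀ k γ, P γ → P (T.edgePair k * γ)) {γ : (ℂ ≃ᵢ ℂ) × (ℂ ≃ᵢ ℂ)} (hγ : γ ∈ T.tileGroup) :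
    P γ := by
  refine Subgroup.closure_induction_left (p := fun γ _ => P γ) one ?_ ?_ hγ
  · rintro _ ⟨k, rfl⟩ γ _ h
    exact mul k γ h
  · rintro _ ⟨k, rfl⟩ γ _ h
    rw [edgePair_inv]
    exact mul k γ h

lemma isConformalPair_edgePair (k : Fin 3) : IsConformalPair (T.edgePair k) :=
  fun _ _ hg => differentiableAt_lineReflection_comp (vertex_ne T.affineIndependent_p k)
    (vertex_ne T.affineIndependent_q k) hg

lemma isConformalPair {γ : (ℂ ≃ᵢ ℂ) × (ℂ ≃ᵢ ℂ)} (hγ : γ ∈ T.tileGroup) : IsConformalPair γ :=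
  tileGroup_induction (P := IsConformalPair) (fun _ _ hg => hg)
    (fun k _ h => (isConformalPair_edgePair k).mul h) hγ

/-- The chain has two links, through a ball about an edge point that carries the Schwarz extension.
-/
lemma transport_edgePair_element (k : Fin 3) :
    T.element.transport (T.edgePair k) (isConformalPair_edgePair k) ∈ T.element.globalFunction := by
  set hp := T.affineIndependent_p
  obtain ⟨x, hx⟩ : (openEdge hp k).Nonempty := by
    rw [← closure_nonempty_iff]
    exact ⟨_, vertex_mem_closure_openEdge hp (fin_three_ne k).2.1.symm⟩
  obtain ⟨r, hr, hd, hball⟩ := exists_ball_differentiableOn_schwarz hx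
  obtain ⟨z, hz, hzpos⟩ : ∃ z ∈ ball x r, 0 < bary hp k z := by
    obtain ⟨z, hz, hz0⟩ := (dense_bary_ne_zero hp k).inter_open_nonempty _ isOpen_ball
      ⟨x, mem_ball_self hr⟩
    rcases lt_or_gt_of_ne hz0 with h | h
    · refine ⟨_, (hball z hz).1, ?_⟩
      change 0 < bary hp k (edgeReflection hp k z)
      rw [bary_edgeReflection]
      linarith
    · exact ⟨z, hz, h⟩
  let B : FunctionElement := ⟨ball x r, T.schwarz k, isOpen_ball, isConnected_ball hr, hd⟩
  have h1 : FunctionElement.IsDirectContinuation T.element B := by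
    refine ⟨⟨z, (hball z hz).2.1 hzpos, hz⟩, ?_⟩
    rintro w ⟨hw, -⟩
    exact (schwarz_of_nonneg ((mem_openTriangle_iff hp).1 hw k).le).symm
  have h2 : FunctionElement.IsDirectContinuation B
      (T.element.transport (T.edgePair k) (isConformalPair_edgePair k)) := by
    refine ⟨⟨(T.edgePair k).1 z, (hball z hz).1, ?_⟩, ?_⟩
    · change (T.edgePair k).1.symm ((T.edgePair k).1 z) ∈ openTriangle T.p
      rw [IsometryEquiv.symm_apply_apply]
      exact (hball z hz).2.1 hzpos
    · rintro w ⟨-, hw⟩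
      refine schwarz_of_neg ?_
      have := (mem_openTriangle_iff hp).1 (show edgeReflection hp k w ∈ openTriangle T.p from hw) k
      rw [bary_edgeReflection] at this
      linarith
  exact (Relation.ReflTransGen.single h1).tail h2

lemma transport_mem_globalFunction {γ : (ℂ ≃ᵢ ℂ) × (ℂ ≃ᵢ ℂ)} (hγ : γ ∈ T.tileGroup)
    {F : FunctionElement} (hF : F ∈ T.element.globalFunction) :
    F.transport γ (isConformalPair hγ) ∈ T.element.globalFunction := by
  have : ∃ h : IsConformalPair γ, F.transport γ h ∈ T.element.globalFunction := by
    refine tileGroup_induction (P := fun γ => ∃ h : IsConformalPair γ,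
      F.transport γ h ∈ T.element.globalFunction) ⟨fun _ _ hg => hg, hF⟩ ?_ hγ
    rintro k γ ⟨h, hm⟩
    exact ⟨(isConformalPair_edgePair k).mul h,
      FunctionElement.transport_mem_globalFunction (F := F.transport γ h)
        (transport_edgePair_element k) hm⟩
  exact this.2

lemma act_mem_elementPoints {γ : (ℂ ≃ᵢ ℂ) × (ℂ ≃ᵢ ℂ)} (hγ : γ ∈ T.tileGroup) {z : ℂ × ℂ}
    (hz : z ∈ T.element.elementPoints) : act γ z ∈ T.element.elementPoints := by
  obtain ⟨F, hF, hd, he⟩ := hz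
  refine ⟨_, transport_mem_globalFunction hγ hF, ?_, ?_⟩
  · simpa [FunctionElement.transport, act] using hd
  · simp [FunctionElement.transport, act, he]

end TriangularGraph

/-! ### Invariance of the surface under the tile group -/

lemma lineReflection_add {a b : ℂ} (h : a ≠ b) (x y : ℂ) :
    lineReflection a b h (x + y) = lineReflection a b h x + (b - a) / conj (b - a) * conj y := by
  simp only [lineReflection_apply, map_add, map_sub]
  ring

namespace TriangularGraph

variable {T : TriangularGraph}

/-- Reflection turns `w ^ n` into `α * conj w ^ n` with `‖α‖ = 1`. Choosing `κ ^ n = α`, the new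
parameter `κ * conj w` restores the normal form on a disk of the same radius. -/
lemma act_edgePair_mem_algebraicPoints (k : Fin 3) {z : ℂ × ℂ}
    (hz : z ∈ T.element.algebraicPoints) :
    act (T.edgePair k) z ∈ T.element.algebraicPoints := by
  obtain ⟨m, n, hm, hn, ρ, hρ, u, hu, hu0, hw⟩ := hz
  obtain ⟨α, hα, hα1⟩ : ∃ α : ℂ, ‖α‖ = 1 ∧
      ∀ x y, (T.edgePair k).1 (x + y) = (T.edgePair k).1 x + α * conj y :=
    ⟨_, norm_div_conj (sub_ne_zero.2 (vertex_ne T.affineIndependent_p k).symm),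
      lineReflection_add (vertex_ne T.affineIndependent_p k)⟩
  obtain ⟨α', hα', hα1'⟩ : ∃ α : ℂ, ‖α‖ = 1 ∧
      ∀ x y, (T.edgePair k).2 (x + y) = (T.edgePair k).2 x + α * conj y :=
    ⟨_, norm_div_conj (sub_ne_zero.2 (vertex_ne T.affineIndependent_q k).symm),
      lineReflection_add (vertex_ne T.affineIndependent_q k)⟩
  obtain ⟨κ, hκ⟩ := IsAlgClosed.exists_pow_nat_eq α hn
  have hκ1 : ‖κ‖ = 1 := by
    rw [← hκ, norm_pow] at hα
    exact (pow_eq_one_iff_of_nonneg (norm_nonneg _) hn.ne').1 hα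
  have hκ0 : κ ≠ 0 := norm_ne_zero_iff.1 (by rw [hκ1]; exact one_ne_zero)
  have hα0' : α' ≠ 0 := norm_ne_zero_iff.1 (by rw [hα']; exact one_ne_zero)
  have hv : ∀ w : ℂ, ‖conj (κ⁻¹ * w)‖ = ‖w‖ := fun w => by simp [hκ1]
  have hx : ∀ ζ : ℂ, (T.edgePair k).1 z.1 + ζ ^ n =
      (T.edgePair k).1 (z.1 + conj (κ⁻¹ * ζ) ^ n) := by
    intro ζ
    rw [hα1, map_pow, Complex.conj_conj, ← hκ, mul_pow, ← mul_assoc, ← mul_pow,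
      mul_inv_cancel₀ hκ0, one_pow, one_mul]
  refine ⟨m, n, hm, hn, ρ, hρ, fun w => α' * κ⁻¹ ^ m * conj (u (conj (κ⁻¹ * w))), ?_, ?_, ?_⟩
  · intro w hwb
    have hvb : conj (κ⁻¹ * w) ∈ ball (0 : ℂ) ρ := by
      rw [mem_ball_zero_iff, hv]
      simpa using hwb
    have h1 := (hu.differentiableAt (isOpen_ball.mem_nhds hvb)).conj_conj
    rw [Complex.conj_conj] at h1
    have h2 : DifferentiableAt ℂ ((conj ∘ u ∘ conj) ∘ fun w => κ⁻¹ * w) w :=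
      DifferentiableAt.comp (g := conj ∘ u ∘ conj) w h1 (by fun_prop)
    exact (h2.const_mul _).differentiableWithinAt
  · simp [hκ0, hα0', hu0]
  · intro w hwb hw0
    have hvb : conj (κ⁻¹ * w) ∈ ball (0 : ℂ) ρ := by
      rw [mem_ball_zero_iff, hv]
      simpa using hwb
    obtain ⟨F, hF, hd, he⟩ := hw _ hvb (by simp [hκ0, hw0])
    refine ⟨_, FunctionElement.transport_mem_globalFunction (transport_edgePair_element k) hF, ?_, ?_⟩
    · change (T.edgePair k).1.symm ((T.edgePair k).1 z.1 + w ^ n) ∈ F.dom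
      rw [hx, IsometryEquiv.symm_apply_apply]
      exact hd
    · have hct : ContinuousAt (fun ζ : ℂ => conj (κ⁻¹ * ζ)) w := by
        have : Continuous (fun ζ : ℂ => conj (κ⁻¹ * ζ)) := by fun_prop
        exact this.continuousAt
      filter_upwards [hct.eventually he] with ζ hζ
      change (T.edgePair k).2 (F.fn ((T.edgePair k).1.symm ((T.edgePair k).1 z.1 + ζ ^ n))) =
        (T.edgePair k).2 z.2 + _
      rw [hx, IsometryEquiv.symm_apply_apply, hζ, hα1', map_mul, map_pow, Complex.conj_conj]
      ring

lemma act_mem_surface {γ : (ℂ ≃ᵢ ℂ) × (ℂ ≃ᵢ ℂ)} (hγ : γ ∈ T.tileGroup) {z : ℂ × ℂ}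
    (hz : z ∈ T.surface) : act γ z ∈ T.surface := by
  refine tileGroup_induction (P := fun γ => act γ z ∈ T.surface) hz ?_ hγ
  intro k γ h
  rw [act_mul]
  rcases h with h | h
  · exact Or.inl (act_mem_elementPoints (edgePair_mem k) h)
  · exact Or.inr (act_edgePair_mem_algebraicPoints k h)

end TriangularGraph

/-! ## The lattice group -/

lemma mem_latticeGroup_iff {S : Set (ℂ × ℂ)} {w : ℂ × ℂ} :
    w ∈ latticeGroup S ↔ ∀ z, z + w ∈ S ↔ z ∈ S := by
  change translation w ∈ isometryGroup S ↔ _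
  rw [isometryGroup, Subgroup.mem_inf, MulAction.mem_stabilizer_set]
  refine ⟨fun h => h.2, fun h => ⟨Subgroup.subset_closure (Or.inr ⟨w, rfl⟩), h⟩⟩

/-- A real linear relation would be a kernel vector of the Gram matrix. -/
lemma linearIndependent_of_latticeDet_ne_zero {b : Fin 4 → ℂ × ℂ} (h : latticeDet b ≠ 0) :
    LinearIndependent ℝ b := by
  rw [Fintype.linearIndependent_iff]
  intro c hc
  have hmul : (Matrix.of fun i j => euclInner (b i) (b j)).mulVec c = 0 := by
    ext i
    have h1 : ∑ j, c j • (b j).1 = 0 := by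
      simpa only [Prod.fst_sum, Prod.smul_fst, Prod.fst_zero] using congrArg Prod.fst hc
    have h2 : ∑ j, c j • (b j).2 = 0 := by
      simpa only [Prod.snd_sum, Prod.smul_snd, Prod.snd_zero] using congrArg Prod.snd hc
    have h3 : inner ℝ (b i).1 (∑ j, c j • (b j).1) + inner ℝ (b i).2 (∑ j, c j • (b j).2) = 0 := by
      rw [h1, h2]
      simp
    simp only [inner_sum, inner_smul_right] at h3
    rw [Pi.zero_apply, ← h3, ← Finset.sum_add_distrib]
    change ∑ j, euclInner (b i) (b j) * c j = _
    refine Finset.sum_congr rfl fun j _ => ?_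
    rw [euclInner]
    ring
  exact congrFun (Matrix.eq_zero_of_mulVec_eq_zero h hmul)

lemma IsCrystallographic.exists_basis {S : Set (ℂ × ℂ)} (h : IsCrystallographic S) :
    ∃ b : Module.Basis (Fin 4) ℝ (ℂ × ℂ),
      ∀ w, w ∈ latticeGroup S ↔ w ∈ Submodule.span ℤ (range b) := by
  obtain ⟨b, -, hb, hdet⟩ := h
  have hli := linearIndependent_of_latticeDet_ne_zero (Real.sqrt_pos.1 hdet).ne'
  refine ⟨basisOfLinearIndependentOfCardEqFinrank hli (by simp [Complex.finrank_real_complex]),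
    fun w => ?_⟩
  rw [coe_basisOfLinearIndependentOfCardEqFinrank, ← hb, ← Submodule.span_int_eq_addSubgroupClosure]
  rfl

/-! ## Linear parts -/

/-- The linear part of a pair of isometries. -/
def linPart (γ : (ℂ ≃ᵢ ℂ) × (ℂ ≃ᵢ ℂ)) : ℂ × ℂ →ₗ[ℝ] ℂ × ℂ :=
  LinearMap.prodMap γ.1.toRealLinearIsometryEquiv.toLinearEquiv.toLinearMap
    γ.2.toRealLinearIsometryEquiv.toLinearEquiv.toLinearMap

lemma linPart_apply (γ : (ℂ ≃ᵢ ℂ) × (ℂ ≃ᵢ ℂ)) (z : ℂ × ℂ) :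
    linPart γ z = act γ z - act γ 0 := by
  simp [linPart, act]

lemma act_add (γ : (ℂ ≃ᵢ ℂ) × (ℂ ≃ᵢ ℂ)) (z w : ℂ × ℂ) :
    act γ (z + w) = act γ z + linPart γ w := by
  have h := map_add (linPart γ) z w
  rw [linPart_apply γ (z + w), linPart_apply γ z] at h
  rw [← sub_eq_zero] at h ⊢
  rw [← h]
  abel

lemma norm_linPart (γ : (ℂ ≃ᵢ ℂ) × (ℂ ≃ᵢ ℂ)) (z : ℂ × ℂ) : ‖linPart γ z‖ = ‖z‖ := by
  rw [linPart_apply, ← dist_eq_norm, dist_act, dist_zero_right]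

lemma eq_of_linPart_eq {γ γ' : (ℂ ≃ᵢ ℂ) × (ℂ ≃ᵢ ℂ)} (h : linPart γ = linPart γ')
    (h0 : act γ 0 = act γ' 0) : γ = γ' := by
  have hz : ∀ z, act γ z = act γ' z := fun z => by
    have := act_add γ 0 z
    have h' := act_add γ' 0 z
    rw [zero_add] at this h'
    rw [this, h', h, h0]
  refine Prod.ext (IsometryEquiv.ext fun x => ?_) (IsometryEquiv.ext fun y => ?_)
  · exact congrArg Prod.fst (hz (x, 0))
  · exact congrArg Prod.snd (hz (0, y))

namespace TriangularGraph

variable {T : TriangularGraph}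

lemma act_mem_surface_iff {γ : (ℂ ≃ᵢ ℂ) × (ℂ ≃ᵢ ℂ)} (hγ : γ ∈ T.tileGroup) {z : ℂ × ℂ} :
    act γ z ∈ T.surface ↔ z ∈ T.surface := by
  refine ⟨fun h => ?_, act_mem_surface hγ⟩
  have := act_mem_surface (T.tileGroup.inv_mem hγ) h
  rwa [act_inv_act] at this

/-- Conjugating translation by `w` with `γ` gives translation by `linPart γ w`. -/
lemma linPart_mem_latticeGroup {γ : (ℂ ≃ᵢ ℂ) × (ℂ ≃ᵢ ℂ)} (hγ : γ ∈ T.tileGroup) {w : ℂ × ℂ}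
    (hw : w ∈ latticeGroup T.surface) : linPart γ w ∈ latticeGroup T.surface := by
  rw [mem_latticeGroup_iff] at hw ⊢
  intro z
  have h := act_add γ (act γ⁻¹ z) w
  rw [act_act_inv] at h
  rw [← h, act_mem_surface_iff hγ, hw, act_mem_surface_iff (T.tileGroup.inv_mem hγ)]

/-- Here `γ * γ'⁻¹` is a translation preserving the surface. -/
lemma sub_mem_latticeGroup {γ γ' : (ℂ ≃ᵢ ℂ) × (ℂ ≃ᵢ ℂ)} (hγ : γ ∈ T.tileGroup)
    (hγ' : γ' ∈ T.tileGroup) (h : linPart γ = linPart γ') :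
    act γ 0 - act γ' 0 ∈ latticeGroup T.surface := by
  rw [mem_latticeGroup_iff]
  intro z
  have h1 := linPart_apply γ (act γ'⁻¹ z)
  have h2 := linPart_apply γ' (act γ'⁻¹ z)
  rw [act_act_inv] at h2
  rw [h, h2] at h1
  have h3 : z + (act γ 0 - act γ' 0) = act γ (act γ'⁻¹ z) := by
    rw [eq_sub_iff_add_eq] at h1
    rw [← h1]
    abel
  rw [h3, act_mem_surface_iff hγ, act_mem_surface_iff (T.tileGroup.inv_mem hγ')]

variable (T) in
/-- The orbit of the origin under the group generated by the reflections meets disks of a given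
radius in a bounded number of points, counted with multiplicity. -/
def HasUniformlyFiniteOrbit : Prop :=
  ∀ R : ℝ, ∃ N : ℕ, ∀ z, {γ | γ ∈ T.tileGroup ∧ dist (act γ 0) z < R}.encard ≤ N

lemma hasUniformlyFiniteOrbit (hT : IsCrystallographic T.surface) :
    T.HasUniformlyFiniteOrbit := by
  obtain ⟨b, hb⟩ := hT.exists_basis
  intro R
  have hfin : ∀ s : Set (ℂ × ℂ), Bornology.IsBounded s →
      (s ∩ latticeGroup T.surface).Finite := by
    intro s hs
    refine (ZSpan.setFinite_inter b hs).subset (inter_subset_inter_right _ fun w hw => ?_)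
    exact (hb w).1 hw
  -- Possible images of the basis under linear parts: lattice vectors no longer than the basis
  -- vectors.
  have hA : {φ : Fin 4 → ℂ × ℂ |
      ∀ i, φ i ∈ closedBall 0 ‖b i‖ ∩ (latticeGroup T.surface : Set (ℂ × ℂ))}.Finite :=
    Set.Finite.pi' fun i => hfin _ isBounded_closedBall
  have hB := hfin (ball 0 (R + R)) isBounded_ball
  refine ⟨(hA.prod hB).toFinset.card, fun z => ?_⟩
  rw [← Set.Finite.encard_eq_coe_toFinset_card]
  set G := {γ | γ ∈ T.tileGroup ∧ dist (act γ 0) z < R}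
  let Φ : (ℂ ≃ᵢ ℂ) × (ℂ ≃ᵢ ℂ) → Fin 4 → ℂ × ℂ := fun γ i => linPart γ (b i)
  have hΦ : ∀ {γ γ'}, Φ γ = Φ γ' → linPart γ = linPart γ' := fun h => b.ext (congrFun h)
  -- A representative in `G` for each linear part. Subtracting its orbit point gives a lattice
  -- vector of norm below `R + R`, so the bound does not depend on `z`.
  let ι : (ℂ ≃ᵢ ℂ) × (ℂ ≃ᵢ ℂ) → (ℂ ≃ᵢ ℂ) × (ℂ ≃ᵢ ℂ) := fun γ => Function.invFunOn Φ G (Φ γ)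
  have hι : ∀ γ ∈ G, ι γ ∈ G ∧ Φ (ι γ) = Φ γ := fun γ hγ =>
    ⟨Function.invFunOn_mem ⟨γ, hγ, rfl⟩, Function.invFunOn_eq ⟨γ, hγ, rfl⟩⟩
  refine encard_le_encard_of_injOn (f := fun γ => (Φ γ, act γ 0 - act (ι γ) 0)) ?_ ?_
  · intro γ hγ
    obtain ⟨h1, h2⟩ := hι γ hγ
    refine ⟨fun i => ⟨?_, linPart_mem_latticeGroup hγ.1 ((hb _).2
      (Submodule.subset_span (mem_range_self i)))⟩, ?_,
      sub_mem_latticeGroup hγ.1 h1.1 (hΦ h2.symm)⟩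
    · rw [mem_closedBall_zero_iff]
      exact (norm_linPart γ (b i)).le
    · rw [mem_ball_zero_iff, ← dist_eq_norm]
      exact (dist_triangle_right _ _ z).trans_lt (add_lt_add hγ.2 h1.2)
  · intro γ hγ γ' hγ' h
    obtain ⟨h1, h2⟩ := Prod.mk.inj h
    refine eq_of_linPart_eq (hΦ h1) ?_
    have : ι γ = ι γ' := congrArg (Function.invFunOn Φ G) h1
    rw [this] at h2
    exact sub_left_injective h2

/-! ## The tiles -/

variable (T) in
/-- The graph of `f` over the closed triangle. -/
def tile : Set (ℂ × ℂ) := (fun x => (x, T.f x)) '' closedTriangle T.p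

variable (T) in
/-- The union of the images of the closed triangular graph. -/
def tiling : Set (ℂ × ℂ) := ⋃ γ : T.tileGroup, act γ '' T.tile

lemma isCompact_tile : IsCompact T.tile :=
  isCompact_closedTriangle.image_of_continuousOn (continuousOn_id.prodMk T.continuousOn_f)

lemma continuous_act (γ : (ℂ ≃ᵢ ℂ) × (ℂ ≃ᵢ ℂ)) : Continuous (act γ) :=
  (γ.1.continuous.comp continuous_fst).prodMk (γ.2.continuous.comp continuous_snd)

lemma exists_dist_act_le : ∃ D : ℝ, ∀ γ, ∀ z ∈ act γ '' T.tile, dist (act γ 0) z ≤ D := by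
  obtain ⟨D, hD⟩ := T.isCompact_tile.isBounded.subset_closedBall 0
  refine ⟨D, ?_⟩
  rintro γ _ ⟨z, hz, rfl⟩
  rw [dist_act, dist_comm]
  exact hD hz

lemma HasUniformlyFiniteOrbit.exists_encard_le (h : T.HasUniformlyFiniteOrbit) (r : ℝ) :
    ∃ N : ℕ, ∀ z, {γ | γ ∈ T.tileGroup ∧ (act γ '' T.tile ∩ ball z r).Nonempty}.encard ≤ N := by
  obtain ⟨D, hD⟩ := T.exists_dist_act_le
  obtain ⟨N, hN⟩ := h (D + r)
  refine ⟨N, fun z => (encard_le_encard ?_).trans (hN z)⟩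
  rintro γ ⟨hγ, w, hw, hwb⟩
  exact ⟨hγ, (dist_triangle _ w z).trans_lt (add_lt_add_of_le_of_lt (hD γ w hw) hwb)⟩

lemma HasUniformlyFiniteOrbit.finite (h : T.HasUniformlyFiniteOrbit) (z : ℂ × ℂ) (r : ℝ) :
    {γ : T.tileGroup | (act γ '' T.tile ∩ ball z r).Nonempty}.Finite := by
  obtain ⟨N, hN⟩ := h.exists_encard_le r
  have hf := Set.finite_of_encard_le_coe (hN z)
  refine (hf.preimage Subtype.val_injective.injOn).subset fun γ hγ => ⟨γ.2, hγ⟩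

lemma HasUniformlyFiniteOrbit.isClosed_tiling (h : T.HasUniformlyFiniteOrbit) :
    IsClosed T.tiling := by
  refine LocallyFinite.isClosed_iUnion (fun z => ⟨ball z 1, ball_mem_nhds z one_pos, h.finite z 1⟩)
    fun γ => ?_
  exact (T.isCompact_tile.image (continuous_act _)).isClosed

lemma HasUniformlyFiniteOrbit.countable (h : T.HasUniformlyFiniteOrbit) :
    Countable T.tileGroup := by
  have : (T.tileGroup : Set ((ℂ ≃ᵢ ℂ) × (ℂ ≃ᵢ ℂ))) ⊆
      ⋃ n : ℕ, {γ | γ ∈ T.tileGroup ∧ dist (act γ 0) 0 < n} := by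
    intro γ hγ
    obtain ⟨n, hn⟩ := exists_nat_gt (dist (act γ 0) 0)
    exact mem_iUnion.2 ⟨n, hγ, hn⟩
  refine Set.Countable.mono this (countable_iUnion fun n => Set.Finite.countable ?_)
  obtain ⟨N, hN⟩ := h n
  exact Set.finite_of_encard_le_coe (hN 0)

end TriangularGraph

namespace TriangularGraph

variable {T : TriangularGraph}

/-! ## The tiles cover the surface -/

variable (T) in
/-- The points near which a function element agrees with an image of the triangular graph under
`γ`. -/
def tilePoints (F : FunctionElement) (γ : (ℂ ≃ᵢ ℂ) × (ℂ ≃ᵢ ℂ)) : Set ℂ :=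
  {x | γ.1.symm x ∈ openTriangle T.p ∧ F.fn =ᶠ[𝓝 x] fun z => γ.2 (T.f (γ.1.symm z))}

variable (T) in
/-- The points near which a function element agrees with some image of the triangular graph. -/
def tiledPoints (F : FunctionElement) : Set ℂ := ⋃ γ : T.tileGroup, T.tilePoints F γ

lemma isOpen_tiledPoints (F : FunctionElement) : IsOpen (T.tiledPoints F) := by
  refine isOpen_iUnion fun γ => isOpen_iff_mem_nhds.2 ?_
  rintro x ⟨hx, he⟩
  filter_upwards [γ.1.1.symm.continuous.continuousAt.eventually (isOpen_interior.mem_nhds hx),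
    he.eventuallyEq_nhds] with z h1 h2 using ⟨h1, h2⟩

lemma mk_mem_of_mem_tilePoints {F : FunctionElement} {γ : (ℂ ≃ᵢ ℂ) × (ℂ ≃ᵢ ℂ)} {x : ℂ}
    (hx : x ∈ T.tilePoints F γ) : (x, F.fn x) ∈ act γ '' T.tile := by
  refine ⟨_, ⟨γ.1.symm x, interior_subset hx.1, rfl⟩, ?_⟩
  simp [act, hx.2.eq_of_nhds]

/-- By the identity theorem `F` coincides near `x` with the explicit continuation `g`, which agrees
with tiles near each point of the dense set `A`. -/
lemma mem_nhds_closure_of_schwarz {F : FunctionElement} {x : ℂ} (hx : x ∈ F.dom)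
    (hcl : x ∈ closure (T.tilePoints F 1)) {g : ℂ → ℂ} {r : ℝ} (hr : 0 < r)
    (hg : DifferentiableOn ℂ g (ball x r))
    (hgf : ∀ z ∈ ball x r, z ∈ openTriangle T.p → g =ᶠ[𝓝 z] T.f)
    {A : Set ℂ} (hA : Dense A) (hgA : ∀ z ∈ ball x r, z ∈ A → ∃ γ : T.tileGroup,
      γ.1.1.symm z ∈ openTriangle T.p ∧ g =ᶠ[𝓝 z] fun z => γ.1.2 (T.f (γ.1.1.symm z))) :
    closure (T.tiledPoints F) ∈ 𝓝 x := by
  obtain ⟨s, hs, hsub⟩ := Metric.isOpen_iff.1 (F.isOpen_dom.inter isOpen_ball) x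
    ⟨hx, mem_ball_self hr⟩
  obtain ⟨z, hz, hzF⟩ := mem_closure_iff.1 hcl _ isOpen_ball (mem_ball_self hs)
  have hFan : AnalyticOnNhd ℂ F.fn (ball x s) :=
    (F.differentiableOn_fn.mono fun w hw => (hsub hw).1).analyticOnNhd isOpen_ball
  have hgan : AnalyticOnNhd ℂ g (ball x s) :=
    (hg.mono fun w hw => (hsub hw).2).analyticOnNhd isOpen_ball
  have heq : EqOn F.fn g (ball x s) :=
    hFan.eqOn_of_preconnected_of_eventuallyEq hgan (convex_ball x s).isPreconnected hz
      (hzF.2.trans (hgf z (hsub hz).2 hzF.1).symm)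
  refine Filter.mem_of_superset (ball_mem_nhds x hs)
    ((hA.open_subset_closure_inter isOpen_ball).trans (closure_mono ?_))
  rintro w ⟨hw, hwA⟩
  obtain ⟨γ, h1, h2⟩ := hgA w (hsub hw).2 hwA
  exact mem_iUnion.2 ⟨γ, h1, (heq.eventuallyEq_of_mem (isOpen_ball.mem_nhds hw)).trans h2⟩

lemma mem_nhds_closure_of_mem_closure_tilePoints_one {F : FunctionElement} {x : ℂ} (hx : x ∈ F.dom)
    (hcl : x ∈ closure (T.tilePoints F 1)) (hv : x ∉ range T.p) :
    closure (T.tiledPoints F) ∈ 𝓝 x := by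
  set hp := T.affineIndependent_p
  have hxc : x ∈ closedTriangle T.p :=
    closure_minimal (fun z hz => interior_subset hz.1) isCompact_closedTriangle.isClosed hcl
  rw [mem_closedTriangle_iff hp] at hxc
  by_cases h0 : ∃ k, bary hp k x = 0
  · obtain ⟨k, hk⟩ := h0
    have hxe : x ∈ openEdge hp k := by
      refine ⟨hk, fun j hj => (hxc j).lt_of_ne fun hj0 => hv ?_⟩
      obtain ⟨i, hi⟩ := eq_vertex_of_bary_eq_zero hp hj hj0.symm hk
      exact ⟨i, hi.symm⟩
    obtain ⟨r, hr, hd, hball⟩ := exists_ball_differentiableOn_schwarz hxe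
    refine mem_nhds_closure_of_schwarz hx hcl hr hd (fun z _ hzo => schwarz_eventuallyEq_of_pos
      ((mem_openTriangle_iff hp).1 hzo k)) (dense_bary_ne_zero hp k) fun z hz hz0 => ?_
    rcases lt_or_gt_of_ne hz0 with h | h
    · exact ⟨⟨_, edgePair_mem k⟩, (hball z hz).2.2 h, schwarz_eventuallyEq_of_neg h⟩
    · exact ⟨1, (hball z hz).2.1 h, schwarz_eventuallyEq_of_pos h⟩
  · have hxo : x ∈ openTriangle T.p :=
      (mem_openTriangle_iff hp).2 fun k => (hxc k).lt_of_ne fun h => h0 ⟨k, h.symm⟩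
    obtain ⟨r, hr, hball⟩ := Metric.isOpen_iff.1 isOpen_interior x hxo
    exact mem_nhds_closure_of_schwarz hx hcl hr (T.differentiableOn_f.mono hball)
      (fun _ _ _ => Filter.EventuallyEq.rfl) dense_univ
      fun z hz _ => ⟨1, hball hz, Filter.EventuallyEq.rfl⟩

/-- Transporting `F` by `γ⁻¹` reduces to the original tile. -/
lemma mem_nhds_closure_of_mem_closure_tilePoints {F : FunctionElement}
    {γ : (ℂ ≃ᵢ ℂ) × (ℂ ≃ᵢ ℂ)} (hγ : γ ∈ T.tileGroup) {x : ℂ} (hx : x ∈ F.dom)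
    (hcl : x ∈ closure (T.tilePoints F γ)) (hv : γ.1.symm x ∉ range T.p) :
    closure (T.tiledPoints F) ∈ 𝓝 x := by
  set F' := F.transport γ⁻¹ (isConformalPair (T.tileGroup.inv_mem hγ))
  have hfn : ∀ z, F'.fn z = γ.2.symm (F.fn (γ.1 z)) := fun _ => rfl
  have hx' : γ.1.symm x ∈ F'.dom := by
    change γ.1 (γ.1.symm x) ∈ F.dom
    rwa [IsometryEquiv.apply_symm_apply]
  have hcl' : γ.1.symm x ∈ closure (T.tilePoints F' 1) := by
    refine map_mem_closure γ.1.symm.continuous hcl fun z hz => ⟨hz.1, ?_⟩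
    have hct : Filter.Tendsto γ.1 (𝓝 (γ.1.symm z)) (𝓝 z) := by
      simpa using γ.1.continuous.tendsto (γ.1.symm z)
    filter_upwards [hct.eventually hz.2] with w hw
    rw [hfn, hw, IsometryEquiv.symm_apply_apply, IsometryEquiv.symm_apply_apply]
    rfl
  have hmem := γ.1.symm.continuous.continuousAt.preimage_mem_nhds
    (mem_nhds_closure_of_mem_closure_tilePoints_one hx' hcl' hv)
  refine Filter.mem_of_superset hmem fun z hz => ?_
  have himg : γ.1 (γ.1.symm z) ∈ closure (T.tiledPoints F) := by
    refine map_mem_closure γ.1.continuous hz fun w hw => ?_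
    obtain ⟨δ, hδ, he⟩ := mem_iUnion.1 hw
    refine mem_iUnion.2 ⟨⟨γ, hγ⟩ * δ, ?_, ?_⟩
    · change δ.1.1.symm (γ.1.symm (γ.1 w)) ∈ _
      rwa [IsometryEquiv.symm_apply_apply]
    · have hct : Filter.Tendsto γ.1.symm (𝓝 (γ.1 w)) (𝓝 w) := by
        simpa using γ.1.symm.continuous.tendsto (γ.1 w)
      filter_upwards [hct.eventually he] with v hv
      rw [hfn, IsometryEquiv.apply_symm_apply] at hv
      change F.fn v = γ.2 (δ.1.2 (T.f (δ.1.1.symm (γ.1.symm v))))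
      rw [← hv, IsometryEquiv.apply_symm_apply]
  rwa [IsometryEquiv.apply_symm_apply] at himg

/-- A function element that agrees somewhere with a tile agrees with tiles on a dense set. -/
lemma HasUniformlyFiniteOrbit.dom_subset_closure_tiledPoints (h : T.HasUniformlyFiniteOrbit)
    {F : FunctionElement} (hF : (F.dom ∩ T.tiledPoints F).Nonempty) :
    F.dom ⊆ closure (T.tiledPoints F) := by
  have := h.countable
  refine subset_closure_of_closure_mem_nhds (V := ⋃ γ : T.tileGroup, γ.1.1 '' range T.p)
    F.isOpen_dom F.isConnected_dom.isPreconnected (isOpen_tiledPoints F)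
    (countable_iUnion fun γ => (countable_range _).image _) hF fun x hx hxV hcl => ?_
  have hct : ContinuousAt (fun z => (z, F.fn z)) x :=
    continuousAt_id.prodMk (F.differentiableOn_fn.continuousOn.continuousAt
      (F.isOpen_dom.mem_nhds hx))
  have hfin := h.finite (x, F.fn x) 1
  -- Only finitely many tiles come near `(x, F.fn x)`, so closure commutes with this union and `x`
  -- is a limit of points of a single tile.
  have hcl' : x ∈ closure (⋃ γ ∈ {γ : T.tileGroup |
      (act γ '' T.tile ∩ ball (x, F.fn x) 1).Nonempty}, T.tilePoints F γ) := by
    rw [mem_closure_iff_frequently] at hcl ⊢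
    refine (hcl.and_eventually (hct.eventually (ball_mem_nhds _ one_pos))).mono ?_
    rintro z ⟨hz, hzb⟩
    obtain ⟨γ, hγ⟩ := mem_iUnion.1 hz
    exact mem_iUnion₂.2 ⟨γ, ⟨_, mk_mem_of_mem_tilePoints hγ, hzb⟩, hγ⟩
  rw [hfin.closure_biUnion] at hcl'
  obtain ⟨γ, -, hγ⟩ := mem_iUnion₂.1 hcl'
  refine mem_nhds_closure_of_mem_closure_tilePoints γ.2 hx hγ ?_
  rintro hv
  exact hxV (mem_iUnion.2 ⟨γ, _, hv, IsometryEquiv.apply_symm_apply _ _⟩)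

lemma HasUniformlyFiniteOrbit.inter_tiledPoints_nonempty (h : T.HasUniformlyFiniteOrbit)
    {F : FunctionElement} (hF : F ∈ T.element.globalFunction) :
    (F.dom ∩ T.tiledPoints F).Nonempty := by
  -- The motive is an implication, so the property passes forward along the chain: density puts a
  -- tiled point in each overlap.
  refine Relation.ReflTransGen.head_induction_on
    (motive := fun F' _ => (F'.dom ∩ T.tiledPoints F').Nonempty → _) hF id ?_ ?_
  · rintro F₁ F₂ ⟨⟨x, hx⟩, heq⟩ _ ih hne
    have hopen := F₁.isOpen_dom.inter F₂.isOpen_dom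
    obtain ⟨z, hz, hzt⟩ := mem_closure_iff.1 (h.dom_subset_closure_tiledPoints hne hx.1) _ hopen hx
    obtain ⟨γ, h1, h2⟩ := mem_iUnion.1 hzt
    exact ih ⟨z, hz.2, mem_iUnion.2 ⟨γ, h1,
      (heq.symm.eventuallyEq_of_mem (hopen.mem_nhds hz)).trans h2⟩⟩
  · obtain ⟨x, hx⟩ := (isConnected_openTriangle T.affineIndependent_p).nonempty
    exact ⟨x, hx, mem_iUnion.2 ⟨1, hx, Filter.EventuallyEq.rfl⟩⟩

lemma HasUniformlyFiniteOrbit.elementPoints_subset (h : T.HasUniformlyFiniteOrbit) :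
    T.element.elementPoints ⊆ T.tiling := by
  rintro ⟨x, y⟩ ⟨F, hF, hx, hy⟩
  obtain rfl : F.fn x = y := hy
  have hct : ContinuousAt (fun z => (z, F.fn z)) x :=
    continuousAt_id.prodMk (F.differentiableOn_fn.continuousOn.continuousAt
      (F.isOpen_dom.mem_nhds hx))
  rw [← h.isClosed_tiling.closure_eq]
  refine hct.continuousWithinAt.mem_closure
    (h.dom_subset_closure_tiledPoints (h.inter_tiledPoints_nonempty hF) hx) fun z hz => ?_
  obtain ⟨γ, hγ⟩ := mem_iUnion.1 hz
  exact mem_iUnion.2 ⟨γ, mk_mem_of_mem_tilePoints hγ⟩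

end TriangularGraph

/-! ### Branch points and the bound for sections -/

lemma FunctionElement.algebraicPoints_subset_closure (F₀ : FunctionElement) :
    F₀.algebraicPoints ⊆ closure F₀.elementPoints := by
  rintro ⟨x, y⟩ ⟨m, n, hm, hn, ρ, hρ, u, hu, -, hw⟩
  have huc : ContinuousAt u 0 :=
    hu.continuousOn.continuousAt (isOpen_ball.mem_nhds (mem_ball_self hρ))
  have hct : ContinuousAt (fun w : ℂ => (x + w ^ n, y + w ^ m * u w)) 0 := by fun_prop
  have ht : Filter.Tendsto (fun w : ℂ => (x + w ^ n, y + w ^ m * u w)) (𝓝[≠] 0) (𝓝 (x, y)) := by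
    simpa [hm.ne', hn.ne'] using hct.tendsto.mono_left (nhdsWithin_le_nhds (s := {0}ᶜ))
  refine mem_closure_of_tendsto ht ?_
  filter_upwards [self_mem_nhdsWithin, nhdsWithin_le_nhds (ball_mem_nhds 0 hρ)] with w hw0 hwb
  obtain ⟨F, hF, hd, he⟩ := hw w hwb hw0
  exact ⟨F, hF, hd, he.self_of_nhds⟩

namespace TriangularGraph

variable {T : TriangularGraph}

lemma HasUniformlyFiniteOrbit.surface_subset (h : T.HasUniformlyFiniteOrbit) :
    T.surface ⊆ T.tiling :=
  union_subset h.elementPoints_subset ((T.element.algebraicPoints_subset_closure).trans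
    (closure_minimal h.elementPoints_subset h.isClosed_tiling))

/-- The tile of `γ` has at most one point over `x`, with second coordinate `γ.2 (T.f (γ.1.symm x))`,
so the tiles meeting the unit ball about `(x, y)` bound the count. -/
lemma HasUniformlyFiniteOrbit.isFinitelyDiscrete (h : T.HasUniformlyFiniteOrbit) :
    IsFinitelyDiscrete T.surface := by
  obtain ⟨N, hN⟩ := h.exists_encard_le 1
  refine ⟨1, one_pos, N, fun x y => ?_⟩
  refine (encard_le_encard ?_).trans ((encard_image_le
    (fun γ : (ℂ ≃ᵢ ℂ) × (ℂ ≃ᵢ ℂ) => γ.2 (T.f (γ.1.symm x))) _).trans (hN (x, y)))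
  rintro v ⟨⟨z, ⟨hz, hzx⟩, rfl⟩, hv⟩
  obtain ⟨γ, hγ⟩ := mem_iUnion.1 (h.surface_subset hz)
  refine ⟨γ, ⟨γ.2, z, hγ, ?_⟩, ?_⟩
  · have hzx' : z.1 = x := hzx
    rw [mem_ball, Prod.dist_eq, hzx', dist_self]
    exact max_lt one_pos hv
  · obtain ⟨_, ⟨t, -, rfl⟩, rfl⟩ := hγ
    have hzx' : γ.1.1 t = x := hzx
    simp [← hzx', act]

end TriangularGraph

end TriSurf
end

theorem mainTheorem10 (T : TriSurf.TriangularGraph)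
    (hT : TriSurf.IsCrystallographic T.surface) :
    TriSurf.IsFinitelyDiscrete T.surface := by
  exact (TriSurf.TriangularGraph.hasUniformlyFiniteOrbit hT).isFinitelyDiscrete
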